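/- For a finite simple graph $G=(V,E)$ and $U\subseteq V$ let $N_G(U)$ be the set of vertices of $V\setminus U$ that have a neighbor in $U$. For $\alpha>0$, a graph $G$ on $n$ vertices is called an $\alpha$-expander if $|N_G(U)|\ge\alpha|U|$ for every $U\subseteq V$ with $|U|\le\lceil n/2\rceil$. Theorem. There is an absolute constant $C>0$ such that for every $0<\alpha\le 1$ there are positive constants $A$, $a_1$, $a_2$ with $$A\le\frac{C}{\alpha},\qquad a_1\le\frac{C}{\alpha},\qquad a_2\ge 2^{-C\log_2(2/\alpha)/\alpha},$$ and an integer $n_0$ (depending on $\alpha$) with the following property: for every $n\ge n_0$ and every $\alpha$-expander $G$ on $n$ vertices, and for every integer $\ell\in[a_1\log_2 n,\;a_2 n]$, the graph $G$ contains a cycle whose length $k$ satisfies $\ell\le k\le\ell+A$. -/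

import Mathlib

/-- The external neighborhood of a vertex set `U` in `G`: the vertices outside `U` that have a
neighbor in `U`. -/
def SimpleGraph.externalNeighborhood {V : Type*} (G : SimpleGraph V) (U : Set V) : Set V :=
  {v | v ∉ U ∧ ∃ u ∈ U, G.Adj u v}

/-- A finite graph on `n` vertices is an `α`-expander if every vertex set `U` with
`|U| ≤ ⌈n / 2⌉` has at least `α |U|` external neighbors. -/
def SimpleGraph.IsExpander {V : Type*} [Fintype V] (G : SimpleGraph V) (α : ℝ) : Prop :=
  ∀ U : Set V, U.ncard ≤ ⌈(Fintype.card V : ℝ) / 2⌉₊ →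
    α * (U.ncard : ℝ) ≤ ((G.externalNeighborhood U).ncard : ℝ)

/-- `G` contains a cycle of length `k`. -/
def SimpleGraph.HasCycleOfLength {V : Type*} (G : SimpleGraph V) (k : ℕ) : Prop :=
  ∃ (v : V) (c : G.Walk v v), c.IsCycle ∧ c.length = k

/-! The cycle consists of two disjoint paths, one inside a set `Θ` and one outside it, each of
length controlled up to a multiple of `W`, where `W` is about `1000 / α`. Expansion enters through
separation: a set with few external neighbors is itself small or misses only few vertices. A
monotone sequence of balls has a thin layer in every window of `W` steps, so boundaries of size `O(n
/ W)` are always available.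

Inside: in a breadth-first tree from a vertex whose balls grow fastest, `Θ` consists of the levels
up to a thin level `m`, together with the later vertices that have at least `W ^ 2` descendants
(`IsExpander.exists_hub_tree`). Deleting a short path `P` outside `Θ` cuts off few descendants. For
a given `z` in `Θ`, most tree paths from `z` to the rim of `Θ` branch within distance `W` of the
root, because a subtree hanging at level `W` lies in a ball too small to matter. Hence their lengths
are all close to `lev z + m`.

Outside: the complement of `Θ` contains an expanding core `H` adjacent to `Θ`
(`IsExpander.exists_core`). From a vertex of `H`, a path is extended greedily until the ball of the
remaining radius around suitable neighbors of its end has a trace on `H` of about `n / 100` vertices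
(`exists_path_with_ball`). Path length and radius have a prescribed sum. At that critical radius the
ball passes from a small to a large part of the graph within `O(W)` steps, so all but `n / 50`
vertices are first reached in a window of length `3 * W` (`IsExpander.exists_annulus`).

More than `n / 50` vertices are good for the inside, so some vertex is good for both, and the two
paths close up there (`IsExpander.exists_cycle`). -/

namespace SimpleGraph

/-! ### Paths of exact length inside a set -/

variable {V : Type*} {G : SimpleGraph V}

/-- There is a path of length `k` from `u` to `v` with all vertices in `S`. -/
def HasPathIn (G : SimpleGraph V) (S : Set V) (u v : V) (k : ℕ) : Prop :=
  ∃ p : G.Walk u v, p.IsPath ∧ p.length = k ∧ ∀ x ∈ p.support, x ∈ S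

namespace HasPathIn

lemma refl {S : Set V} {u : V} (hu : u ∈ S) : G.HasPathIn S u u 0 :=
  ⟨Walk.nil, by simp, by simp, by simpa using hu⟩

lemma mono {S T : Set V} {u v : V} {k : ℕ} (h : G.HasPathIn S u v k) (hST : S ⊆ T) :
    G.HasPathIn T u v k := by
  obtain ⟨p, hp, hl, hs⟩ := h
  exact ⟨p, hp, hl, fun x hx => hST (hs x hx)⟩

lemma symm {S : Set V} {u v : V} {k : ℕ} (h : G.HasPathIn S u v k) : G.HasPathIn S v u k := by
  obtain ⟨p, hp, hl, hs⟩ := h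
  exact ⟨p.reverse, hp.reverse, by simpa using hl, fun x hx => hs x (by simpa using hx)⟩

lemma append {S T : Set V} {u v v' w : V} {k l : ℕ} (h : G.HasPathIn S u v k)
    (h' : G.HasPathIn T v' w l) (hST : Disjoint S T) (ha : G.Adj v v') :
    G.HasPathIn (S ∪ T) u w (k + l + 1) := by
  obtain ⟨p, hp, hl, hs⟩ := h
  obtain ⟨q, hq, hl', hs'⟩ := h'
  have hsup : (p.append (Walk.cons ha q)).support = p.support ++ q.support := by
    rw [Walk.support_append]; simp
  refine ⟨p.append (Walk.cons ha q), ?_, by simp [hl, hl']; omega, ?_⟩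
  · rw [Walk.isPath_def, hsup, List.nodup_append]
    refine ⟨hp.support_nodup, hq.support_nodup, ?_⟩
    rintro a ha b hb rfl
    exact Set.disjoint_left.1 hST (hs a ha) (hs' a hb)
  · intro x hx
    rw [hsup, List.mem_append] at hx
    exact hx.imp (hs x) (hs' x)

lemma cons {S : Set V} {u v w : V} {l : ℕ} (h : G.HasPathIn S v w l) (hu : u ∉ S)
    (ha : G.Adj u v) : G.HasPathIn (insert u S) u w (l + 1) := by
  have := (refl (G := G) (Set.mem_singleton u)).append h
    (Set.disjoint_singleton_left.2 hu) ha
  rwa [zero_add, ← Set.insert_eq] at this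

/-- Two disjoint paths, joined at both ends by edges, form a cycle. -/
lemma hasCycleOfLength {S T : Set V} {u v u' v' : V} {k l : ℕ} (h : G.HasPathIn S u v k)
    (h' : G.HasPathIn T u' v' l) (hST : Disjoint S T) (ha : G.Adj v u') (hb : G.Adj v' u)
    (hkl : 1 ≤ k + l) : G.HasCycleOfLength (k + l + 2) := by
  have hr := h.append h' hST ha
  obtain ⟨p, hp, hl, hs⟩ := h
  obtain ⟨q, hq, hl', hs'⟩ := h'
  have hsup : (p.append (Walk.cons ha q)).support = p.support ++ q.support := by
    rw [Walk.support_append]; simp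
  have hpath : (p.append (Walk.cons ha q)).IsPath := by
    rw [Walk.isPath_def, hsup, List.nodup_append]
    refine ⟨hp.support_nodup, hq.support_nodup, ?_⟩
    rintro a ha b hb rfl
    exact Set.disjoint_left.1 hST (hs a ha) (hs' a hb)
  refine ⟨v', Walk.cons hb (p.append (Walk.cons ha q)), ?_, by simp [hl, hl']; omega⟩
  rw [Walk.cons_isCycle_iff]
  refine ⟨hpath, ?_⟩
  rw [Walk.edges_append, Walk.edges_cons, List.mem_append, List.mem_cons]
  rintro (h1 | h1 | h1)
  · exact Set.disjoint_left.1 hST (hs _ (p.fst_mem_support_of_mem_edges h1))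
      (hs' _ q.end_mem_support)
  · rcases Sym2.eq_iff.1 h1 with ⟨e1, -⟩ | ⟨e1, e2⟩
    · subst e1
      exact Set.disjoint_left.1 hST (hs _ p.end_mem_support) (hs' _ q.end_mem_support)
    -- The two joining edges coincide only if both paths are single vertices, which `hkl` excludes.
    · subst e1 e2
      have h1 := Walk.length_eq_zero_iff.2 (Walk.isPath_iff_nil.1 hp)
      have h2 := Walk.length_eq_zero_iff.2 (Walk.isPath_iff_nil.1 hq)
      omega
  · exact Set.disjoint_left.1 hST (hs _ p.start_mem_support)
      (hs' _ (q.snd_mem_support_of_mem_edges h1))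

end HasPathIn

/-! ### Balls inside a vertex set -/

/-- The vertices of `A` that can be reached from `X ∩ A` by at most `i` steps inside `A`. -/
def reach (G : SimpleGraph V) (A X : Set V) : ℕ → Set V
  | 0 => X ∩ A
  | i + 1 => reach G A X i ∪ {v | v ∈ A ∧ ∃ u ∈ reach G A X i, G.Adj u v}

section reach

variable {A X : Set V}

lemma reach_subset (i : ℕ) : G.reach A X i ⊆ A := by
  induction i with
  | zero => exact Set.inter_subset_right
  | succ i ih => exact Set.union_subset ih fun v hv => hv.1

lemma reach_mono : Monotone (G.reach A X) :=
  monotone_nat_of_le_succ fun _ => Set.subset_union_left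

lemma mem_reach_succ_of_adj {i : ℕ} {u v : V} (hu : u ∈ G.reach A X i) (hv : v ∈ A)
    (h : G.Adj u v) : v ∈ G.reach A X (i + 1) :=
  Or.inr ⟨hv, u, hu, h⟩

/-- Lets a family of balls around selected neighbors be treated as one ball with several seeds. -/
lemma reach_union_seeds (i : ℕ) : G.reach A X i = ⋃ x ∈ X, G.reach A {x} i := by
  induction i with
  | zero => ext v; simp [reach]
  | succ i ih =>
    ext v
    constructor
    · rintro (hv | ⟨hvA, u, hu, ha⟩)
      · rw [ih, Set.mem_iUnion₂] at hv
        obtain ⟨x, hx, hv⟩ := hv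
        exact Set.mem_iUnion₂.2 ⟨x, hx, Or.inl hv⟩
      · rw [ih, Set.mem_iUnion₂] at hu
        obtain ⟨x, hx, hu⟩ := hu
        exact Set.mem_iUnion₂.2 ⟨x, hx, mem_reach_succ_of_adj hu hvA ha⟩
    · intro hv
      obtain ⟨x, hx, hv⟩ := Set.mem_iUnion₂.1 hv
      have hsub : G.reach A {x} i ⊆ G.reach A X i := by
        rw [ih]; exact Set.subset_biUnion_of_mem (u := fun x => G.reach A {x} i) hx
      rcases hv with hv | ⟨hvA, u, hu, ha⟩
      · exact Or.inl (hsub hv)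
      · exact mem_reach_succ_of_adj (hsub hu) hvA ha

lemma reach_trans {x y : V} {i j : ℕ} (hx : x ∈ G.reach A X i) (hy : y ∈ G.reach A {x} j) :
    y ∈ G.reach A X (i + j) := by
  induction j generalizing y with
  | zero =>
    obtain ⟨rfl, -⟩ := hy
    exact hx
  | succ j ih =>
    rcases hy with hy | ⟨hyA, u, hu, ha⟩
    · exact reach_mono (Nat.le_succ _) (ih hy)
    · exact mem_reach_succ_of_adj (ih hu) hyA ha

lemma mem_reach_self {x : V} (hx : x ∈ A) (i : ℕ) : x ∈ G.reach A {x} i :=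
  reach_mono (Nat.zero_le i) ⟨rfl, hx⟩

/-- Together with `reach_trans`, this makes the times at which two vertices are first reached differ
by at most their distance inside `A`. -/
lemma reach_symm {x y : V} {j : ℕ} (hy : y ∈ G.reach A {x} j) : x ∈ G.reach A {y} j := by
  induction j generalizing y with
  | zero =>
    obtain ⟨rfl, h⟩ := hy
    exact ⟨rfl, h⟩
  | succ j ih =>
    rcases hy with hy | ⟨hyA, u, hu, ha⟩
    · exact reach_mono (Nat.le_succ _) (ih hy)
    · have h1 : u ∈ G.reach A {y} 1 :=
        mem_reach_succ_of_adj (mem_reach_self hyA 0) (reach_subset _ hu) ha.symm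
      have := reach_trans h1 (ih hu)
      rwa [add_comm] at this

/-- A vertex first reached at time `i` is the end of a path of length exactly `i`. -/
lemma exists_hasPathIn_of_first {i : ℕ} {v : V} (hv : v ∈ G.reach A X i)
    (hfirst : ∀ j < i, v ∉ G.reach A X j) :
    ∃ x ∈ X, G.HasPathIn (G.reach A X i) x v i := by
  induction i generalizing v with
  | zero => exact ⟨v, hv.1, HasPathIn.refl hv⟩
  | succ i ih =>
    have hvi := hfirst i (Nat.lt_succ_self i)
    rcases hv with hv | ⟨hvA, u, hu, ha⟩
    · exact absurd hv hvi
    -- The predecessor is also reached for the first time, since otherwise `v` would have been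
    -- reached earlier. As `v` is new at time `i + 1`, it does not lie on the path to `u`.
    · have hu' : ∀ j < i, u ∉ G.reach A X j := fun j hj huj =>
        hfirst (j + 1) (by omega) (mem_reach_succ_of_adj huj hvA ha)
      obtain ⟨x, hx, hp⟩ := ih hu hu'
      refine ⟨x, hx, ((hp.symm.cons hvi ha.symm).symm).mono ?_⟩
      exact Set.insert_subset (mem_reach_succ_of_adj hu hvA ha) (reach_mono (Nat.le_succ i))

/-- Removing the source splits a ball into the balls around the neighbors of the source. -/
lemma reach_singleton_succ_subset {v : V} (i : ℕ) :
    G.reach A {v} (i + 1) ⊆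
      insert v (⋃ u ∈ {u | G.Adj v u ∧ u ∈ A \ {v}}, G.reach (A \ {v}) {u} i) := by
  induction i with
  | zero =>
    rintro x (hx | ⟨hxA, u, hu, ha⟩)
    · exact Or.inl hx.1
    · obtain ⟨rfl, -⟩ := hu
      by_cases hxu : x = u
      · exact Or.inl hxu
      · exact Or.inr (Set.mem_iUnion₂.2 ⟨x, ⟨ha, hxA, hxu⟩, mem_reach_self (Set.mem_sdiff_singleton.2 ⟨hxA, hxu⟩) 0⟩)
  | succ i ih =>
    rintro x (hx | ⟨hxA, u, hu, ha⟩)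
    · rcases ih hx with h | h
      · exact Or.inl h
      · obtain ⟨y, hy, hxy⟩ := Set.mem_iUnion₂.1 h
        exact Or.inr (Set.mem_iUnion₂.2 ⟨y, hy, reach_mono (Nat.le_succ i) hxy⟩)
    · by_cases hxv : x = v
      · exact Or.inl hxv
      · rcases ih hu with h | h
        · subst h
          exact Or.inr (Set.mem_iUnion₂.2
            ⟨x, ⟨ha, hxA, hxv⟩, mem_reach_self (Set.mem_sdiff_singleton.2 ⟨hxA, hxv⟩) _⟩)
        · obtain ⟨y, hy, huy⟩ := Set.mem_iUnion₂.1 h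
          exact Or.inr (Set.mem_iUnion₂.2 ⟨y, hy, mem_reach_succ_of_adj huy ⟨hxA, hxv⟩ ha⟩)

end reach

end SimpleGraph

/-! ### Growth, thin layers, and the path followed by a critical ball -/

namespace SimpleGraph

/-- A monotone sequence that grows by the factor `1 + β` until it exceeds `M`. -/
lemma lt_or_pow_le_of_growth {f : ℕ → ℝ} {s β M : ℝ} (hs : s ≤ f 0) (hβ : 0 ≤ β)
    (hmono : Monotone f) (hf : ∀ i, f i ≤ M → (1 + β) * f i ≤ f (i + 1)) (k : ℕ) :
    M < f k ∨ (1 + β) ^ k * s ≤ f k := by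
  induction k with
  | zero => right; simpa using hs
  | succ k ih =>
    rcases lt_or_ge M (f k) with h | h
    · exact Or.inl (h.trans_le (hmono (Nat.le_succ k)))
    · rcases ih with h' | h'
      · exact absurd h' (not_lt.2 h)
      · right
        calc (1 + β) ^ (k + 1) * s = (1 + β) * ((1 + β) ^ k * s) := by ring
          _ ≤ (1 + β) * f k := by gcongr
          _ ≤ f (k + 1) := hf k h

variable {V : Type*} {G : SimpleGraph V}

/-- A union of small sets contains a subunion of prescribed size, up to a factor two. -/
lemma exists_subunion_ncard [Finite V] (f : V → Set V) (H : Set V) (σ : ℕ) (N : Set V)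
    (hf : ∀ u ∈ N, (f u ∩ H).ncard ≤ σ) (hN : σ ≤ ((⋃ u ∈ N, f u) ∩ H).ncard) :
    ∃ N' ⊆ N, σ ≤ ((⋃ u ∈ N', f u) ∩ H).ncard ∧ ((⋃ u ∈ N', f u) ∩ H).ncard ≤ 2 * σ := by
  induction N, N.toFinite using Set.Finite.induction_on with
  | empty => exact ⟨∅, le_rfl, hN, by simp⟩
  | @insert a s _ _ ih =>
    by_cases h : σ ≤ ((⋃ u ∈ s, f u) ∩ H).ncard
    · obtain ⟨N', h1, h2⟩ := ih (fun u hu => hf u (Or.inr hu)) h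
      exact ⟨N', h1.trans (Set.subset_insert a s), h2⟩
    -- Before `a` was added the trace was below `σ`, and `a` contributes at most `σ`.
    · refine ⟨insert a s, le_rfl, hN, ?_⟩
      have h1 : (⋃ u ∈ insert a s, f u) ∩ H = (f a ∩ H) ∪ ((⋃ u ∈ s, f u) ∩ H) := by
        rw [Set.biUnion_insert, Set.union_inter_distrib_right]
      rw [h1]
      have h2 := Set.ncard_union_le (f a ∩ H) ((⋃ u ∈ s, f u) ∩ H)
      have h3 := hf a (Or.inl rfl)
      omega

/-- Along a monotone sequence of vertex sets, one of `W` consecutive increments is small. -/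
lemma exists_small_increment [Fintype V] {S : ℕ → Set V} (hS : Monotone S) (s W : ℕ) (hW : 1 ≤ W) :
    ∃ i, s ≤ i ∧ i < s + W ∧ (S (i + 1) \ S i).ncard * W ≤ Fintype.card V := by
  by_contra! h
  have hcard : ∀ i, (S (i + 1)).ncard = (S i).ncard + (S (i + 1) \ S i).ncard := fun i => by
    have := Set.ncard_sdiff_add_ncard_of_subset (hS (Nat.le_succ i))
    rw [Nat.succ_eq_add_one] at this
    omega
  have hle : (S (s + W)).ncard ≤ Fintype.card V := by
    rw [← Nat.card_eq_fintype_card]; exact Set.ncard_le_card _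
  -- If every increment exceeded `n / W`, then `W` of them would exceed `n`; the term `n + 1`
  -- records the strict inequality between integers.
  have key : ∀ k ≤ W, k * (Fintype.card V + 1) ≤ (S (s + k)).ncard * W := by
    intro k
    induction k with
    | zero => simp
    | succ k ih =>
      intro hk
      have h1 := ih (by omega)
      have h2 := h (s + k) (by omega) (by omega)
      have h3 := hcard (s + k)
      rw [show s + (k + 1) = s + k + 1 by ring, h3]
      nlinarith
  have := key W le_rfl
  have h4 : W * (Fintype.card V + 1) ≤ Fintype.card V * W :=
    this.trans (Nat.mul_le_mul_right W hle)
  nlinarith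

/-- From a vertex whose ball of radius `L` has a large trace on `H`, there is a path followed by a
ball that starts at neighbors of its end, has a trace on `H` of prescribed size, and has exactly the
radius that remains. -/
lemma exists_path_with_ball [Finite V] (H : Set V) (σ : ℕ) (hσ : 1 ≤ σ) (L : ℕ) (A : Set V) (v : V)
    (hvA : v ∈ A) (hL : σ < (G.reach A {v} L ∩ H).ncard) :
    ∃ (j r : ℕ) (P : Set V) (w : V) (N : Set V), j + r + 1 = L ∧ P ⊆ A ∧ P.ncard = j + 1 ∧
      G.HasPathIn P v w j ∧ (∀ u ∈ N, G.Adj w u) ∧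
      σ ≤ (G.reach (A \ P) N r ∩ H).ncard ∧ (G.reach (A \ P) N r ∩ H).ncard ≤ 2 * σ := by
  induction L generalizing A v with
  | zero =>
    have h1 : G.reach A {v} 0 ∩ H ⊆ {v} := fun x hx => hx.1.1
    have := Set.ncard_le_ncard h1
    rw [Set.ncard_singleton] at this
    omega
  | succ L ih =>
    -- The path advances as long as some neighbor has a ball, of radius one less and avoiding `v`,
    -- whose trace is still above `σ`.
    by_cases h : ∃ u, G.Adj v u ∧ u ∈ A \ {v} ∧ σ < (G.reach (A \ {v}) {u} L ∩ H).ncard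
    · obtain ⟨u, hvu, huA, hu⟩ := h
      obtain ⟨j, r, P, w, N, hjr, hPA, hPc, hP, hN, hN1, hN2⟩ := ih (A \ {v}) u huA hu
      have hvP : v ∉ P := fun h => (hPA h).2 rfl
      have hA : A \ insert v P = (A \ {v}) \ P := by
        ext x; simp [not_or, and_assoc]
      refine ⟨j + 1, r, insert v P, w, N, by omega, ?_, ?_, hP.cons hvP hvu, hN, ?_, ?_⟩
      · exact Set.insert_subset hvA (hPA.trans Set.sdiff_subset)
      · rw [Set.ncard_insert_of_notMem hvP, hPc]
      · rwa [hA]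
      · rwa [hA]
    -- The path stops here: each neighbor's ball has trace at most `σ`, but their union has at least
    -- `σ` because only `v` itself can be lost. A subunion is then of the right size.
    · push Not at h
      have hsub := reach_singleton_succ_subset (G := G) (A := A) (v := v) L
      have hcard : σ ≤ ((⋃ u ∈ {u | G.Adj v u ∧ u ∈ A \ {v}}, G.reach (A \ {v}) {u} L) ∩ H).ncard := by
        have h1 : G.reach A {v} (L + 1) ∩ H ⊆
            insert v ((⋃ u ∈ {u | G.Adj v u ∧ u ∈ A \ {v}}, G.reach (A \ {v}) {u} L) ∩ H) := by
          rintro x ⟨hx, hxH⟩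
          rcases hsub hx with h | h
          · exact Or.inl h
          · exact Or.inr ⟨h, hxH⟩
        have h2 := Set.ncard_le_ncard h1
        have h3 := Set.ncard_insert_le v
          ((⋃ u ∈ {u | G.Adj v u ∧ u ∈ A \ {v}}, G.reach (A \ {v}) {u} L) ∩ H)
        omega
      obtain ⟨N, hNs, hN1, hN2⟩ := exists_subunion_ncard (fun u => G.reach (A \ {v}) {u} L) H σ
        {u | G.Adj v u ∧ u ∈ A \ {v}} (fun u hu => h u hu.1 hu.2) hcard
      rw [← reach_union_seeds] at hN1 hN2
      exact ⟨0, L, {v}, v, N, by omega, Set.singleton_subset_iff.2 hvA, by simp,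
        HasPathIn.refl rfl, fun u hu => (hNs hu).1, hN1, hN2⟩

/-! ### Separation and the expanding core -/

section expander

variable [Fintype V] {α : ℝ}

lemma ncard_le_card (S : Set V) : (S.ncard : ℝ) ≤ Fintype.card V := by
  rw [← Nat.card_eq_fintype_card]; exact_mod_cast Set.ncard_le_card S

lemma IsExpander.mul_ncard_le (hG : G.IsExpander α) {U : Set V}
    (hU : (U.ncard : ℝ) ≤ Fintype.card V / 2) :
    α * U.ncard ≤ (G.externalNeighborhood U).ncard :=
  hG U (Nat.cast_le.1 (hU.trans (Nat.le_ceil _)))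

lemma IsExpander.ball_growth (hG : G.IsExpander α) (c : V) (i : ℕ)
    (hi : ((G.reach Set.univ {c} i).ncard : ℝ) ≤ Fintype.card V / 2) :
    (1 + α) * (G.reach Set.univ {c} i).ncard ≤ (G.reach Set.univ {c} (i + 1)).ncard := by
  have h1 := hG.mul_ncard_le hi
  have hd : Disjoint (G.reach Set.univ {c} i)
      (G.externalNeighborhood (G.reach Set.univ {c} i)) :=
    Set.disjoint_left.2 fun x hx hx' => hx'.1 hx
  have h2 : (G.reach Set.univ {c} i) ∪ (G.externalNeighborhood (G.reach Set.univ {c} i)) ⊆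
      G.reach Set.univ {c} (i + 1) := by
    refine Set.union_subset (reach_mono (Nat.le_succ i)) ?_
    rintro x ⟨-, u, hu, ha⟩
    exact mem_reach_succ_of_adj hu trivial ha
  have h3 := Set.ncard_le_ncard h2
  rw [Set.ncard_union_eq hd] at h3
  have h4 : ((G.reach Set.univ {c} i).ncard : ℝ) +
      (G.externalNeighborhood (G.reach Set.univ {c} i)).ncard ≤
      (G.reach Set.univ {c} (i + 1)).ncard := by exact_mod_cast h3
  linarith

/-- In an expander a small set separates at most a small set from the rest. -/
lemma IsExpander.separation (hG : G.IsExpander α) {R S : Set V}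
    (h : G.externalNeighborhood R ⊆ S) :
    α * R.ncard ≤ S.ncard ∨ α * ((R ∪ S)ᶜ : Set V).ncard ≤ S.ncard := by
  rcases le_or_gt (R.ncard : ℝ) (Fintype.card V / 2) with hR | hR
  · left
    have h1 := hG.mul_ncard_le hR
    have h2 : ((G.externalNeighborhood R).ncard : ℝ) ≤ S.ncard := by
      exact_mod_cast Set.ncard_le_ncard h
    linarith
  · right
    have h0 : (R.ncard : ℝ) + (Rᶜ : Set V).ncard = Fintype.card V := by
      rw [← Nat.card_eq_fintype_card]; exact_mod_cast Set.ncard_add_ncard_compl R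
    have h1 : (((R ∪ S)ᶜ : Set V).ncard : ℝ) ≤ (Rᶜ : Set V).ncard := by
      exact_mod_cast Set.ncard_le_ncard (Set.compl_subset_compl.2 Set.subset_union_left)
    -- No edge joins `R` to the complement of `R ∪ S`, so that complement, which has at most half of
    -- the vertices, also has all its external neighbors in `S`.
    have h2 := hG.mul_ncard_le (U := (R ∪ S)ᶜ) (by linarith)
    have h3 : G.externalNeighborhood (R ∪ S)ᶜ ⊆ S := by
      rintro v ⟨hv, u, hu, ha⟩
      by_contra hvS
      have hvR : v ∈ R := by
        by_contra hvR
        exact hv (by simp [hvR, hvS])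
      have hu' : u ∉ R ∧ u ∉ S := by simpa using hu
      exact hu'.2 (h ⟨hu'.1, v, hvR, ha.symm⟩)
    have h4 : ((G.externalNeighborhood (R ∪ S)ᶜ).ncard : ℝ) ≤ S.ncard := by
      exact_mod_cast Set.ncard_le_ncard h3
    linarith

/-- After the removal of a set with a small inner boundary, a large part of an expander still
expands, and it is adjacent to the removed set. -/
lemma IsExpander.exists_core (hα : 0 < α) (hG : G.IsExpander α) {Θ D : Set V} (hne : Θ.Nonempty)
    (hD : ∀ u ∈ Θ, ∀ v ∉ Θ, G.Adj u v → u ∈ D)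
    (hΘ : (Θ.ncard : ℝ) ≤ Fintype.card V / 5) (hDc : 20 * (D.ncard : ℝ) ≤ α * Fintype.card V) :
    ∃ H ⊆ Θᶜ, (∀ U ⊆ H, (U.ncard : ℝ) ≤ 2 * Fintype.card V / 5 →
      α / 2 * U.ncard ≤ (G.externalNeighborhood U ∩ H).ncard) ∧
      ∃ z ∈ Θ, ∃ v ∈ H, G.Adj z v := by
  -- `B` is a largest set that expands badly outside `Θ`; the core is what remains without it.
  obtain ⟨B, ⟨hB1, hB2, hB3⟩, hBmax⟩ := Set.exists_max_image
    {B : Set V | B ⊆ Θᶜ ∧ (B.ncard : ℝ) ≤ Fintype.card V / 2 ∧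
      ((G.externalNeighborhood B \ Θ).ncard : ℝ) ≤ α / 2 * B.ncard} Set.ncard (Set.toFinite _)
    ⟨∅, by simp, by simp; positivity, by simp [externalNeighborhood]⟩
  -- The neighbors of `B` in `Θ` lie in `D`, so `α |B| ≤ α |B| / 2 + α n / 20`. The resulting bound
  -- `n / 10` leaves room to add `U` of size `2 n / 5` and remain below `n / 2`, where maximality
  -- applies.
  have hBs : (B.ncard : ℝ) ≤ Fintype.card V / 10 := by
    have h1 := hG.mul_ncard_le hB2
    have h2 : G.externalNeighborhood B ⊆ (G.externalNeighborhood B \ Θ) ∪ D := by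
      intro v hv
      by_cases hvΘ : v ∈ Θ
      · obtain ⟨-, u, hu, ha⟩ := hv
        exact Or.inr (hD v hvΘ u (hB1 hu) ha.symm)
      · exact Or.inl ⟨hv, hvΘ⟩
    have h3 : ((G.externalNeighborhood B).ncard : ℝ) ≤
        (G.externalNeighborhood B \ Θ).ncard + D.ncard := by
      exact_mod_cast (Set.ncard_le_ncard h2).trans (Set.ncard_union_le _ _)
    have h4 : α * (B.ncard : ℝ) ≤ α * (Fintype.card V / 10) := by linarith
    exact le_of_mul_le_mul_left h4 hα
  refine ⟨(Θ ∪ B)ᶜ, Set.compl_subset_compl.2 Set.subset_union_left, ?_, ?_⟩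
  · intro U hU hUc
    by_contra! hlt
    have hUne : U.Nonempty := by
      rw [Set.nonempty_iff_ne_empty]
      rintro rfl
      simp at hlt
      have : (0 : ℝ) ≤ ((G.externalNeighborhood (∅ : Set V) ∩ (Θᶜ ∩ Bᶜ)).ncard : ℝ) := by positivity
      linarith
    have hdisj : Disjoint B U := Set.disjoint_left.2 fun x hx hx' => hU hx' (Or.inr hx)
    have hc : ((B ∪ U).ncard : ℝ) = B.ncard + U.ncard := by
      exact_mod_cast Set.ncard_union_eq hdisj
    have hpos : 0 < U.ncard := (Set.ncard_pos).2 hUne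
    have hmem : (B ∪ U) ∈ {B : Set V | B ⊆ Θᶜ ∧ (B.ncard : ℝ) ≤ Fintype.card V / 2 ∧
      ((G.externalNeighborhood B \ Θ).ncard : ℝ) ≤ α / 2 * B.ncard} := by
      refine ⟨Set.union_subset hB1 fun x hx h => hU hx (Or.inl h), by rw [hc]; linarith, ?_⟩
      have h2 : G.externalNeighborhood (B ∪ U) \ Θ ⊆
          (G.externalNeighborhood B \ Θ) ∪ (G.externalNeighborhood U ∩ (Θ ∪ B)ᶜ) := by
        rintro v ⟨⟨hv, u, hu, ha⟩, hvΘ⟩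
        rw [Set.mem_union, not_or] at hv
        rcases hu with hu | hu
        · exact Or.inl ⟨⟨hv.1, u, hu, ha⟩, hvΘ⟩
        · refine Or.inr ⟨⟨hv.2, u, hu, ha⟩, ?_⟩
          rintro (h | h)
          · exact hvΘ h
          · exact hv.1 h
      have h3 : ((G.externalNeighborhood (B ∪ U) \ Θ).ncard : ℝ) ≤
          (G.externalNeighborhood B \ Θ).ncard +
            (G.externalNeighborhood U ∩ (Θ ∪ B)ᶜ).ncard := by
        exact_mod_cast (Set.ncard_le_ncard h2).trans (Set.ncard_union_le _ _)
      rw [hc]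
      linarith
    have := hBmax _ hmem
    rw [Set.ncard_union_eq hdisj] at this
    omega
  -- Without an edge from `Θ` to the core, `Θ ∪ B` would have at most `α |B| / 2` external
  -- neighbors, too few for its size.
  · by_contra! hno
    have hdisj : Disjoint Θ B := Set.disjoint_left.2 fun x hx hx' => hB1 hx' hx
    have hc : ((Θ ∪ B).ncard : ℝ) = Θ.ncard + B.ncard := by
      exact_mod_cast Set.ncard_union_eq hdisj
    have h1 := hG.mul_ncard_le (U := Θ ∪ B) (by rw [hc]; linarith [(Nat.cast_nonneg (Fintype.card V) : (0:ℝ) ≤ _)])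
    have h2 : G.externalNeighborhood (Θ ∪ B) ⊆ G.externalNeighborhood B \ Θ := by
      rintro v ⟨hv, u, hu, ha⟩
      have hv' := hv
      rw [Set.mem_union, not_or] at hv'
      rcases hu with hu | hu
      · exact absurd ha (hno u hu v hv)
      · exact ⟨⟨hv'.2, u, hu, ha⟩, hv'.1⟩
    have h3 : ((G.externalNeighborhood (Θ ∪ B)).ncard : ℝ) ≤
        (G.externalNeighborhood B \ Θ).ncard := by
      exact_mod_cast Set.ncard_le_ncard h2
    have hpos : (0 : ℝ) < Θ.ncard := by exact_mod_cast (Set.ncard_pos).2 hne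
    rw [hc] at h1
    nlinarith [(Nat.cast_nonneg B.ncard : (0:ℝ) ≤ _)]

end expander

end SimpleGraph

/-! ### The annulus: almost all vertices are reached at nearly the same time -/

namespace SimpleGraph

variable {V : Type*} {G : SimpleGraph V} [Fintype V] {α : ℝ}

/-- Inside a set `H` that expands, a ball that already has a large trace on `H` soon has a trace of
size at least a third of the graph. -/
lemma third_lt_ncard_reach (hα : 0 < α) {W : ℕ} (hW : 1000 ≤ α * W) {A P N H : Set V} {r σ : ℕ}
    (hHA : H ⊆ A)
    (hH : ∀ U ⊆ H, (U.ncard : ℝ) ≤ 2 * Fintype.card V / 5 →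
      α / 2 * U.ncard ≤ (G.externalNeighborhood U ∩ H).ncard)
    (hσn : (Fintype.card V : ℝ) ≤ 200 * σ) (hσ0 : 1 ≤ σ) (hP : (P.ncard : ℝ) ≤ α / 4 * σ)
    (hσ : σ ≤ (G.reach (A \ P) N r ∩ H).ncard) :
    (Fintype.card V : ℝ) / 3 < (G.reach (A \ P) N (r + W) ∩ H).ncard := by
  have hn : (0 : ℝ) ≤ Fintype.card V := Nat.cast_nonneg _
  obtain ⟨U, hU⟩ : ∃ U : ℕ → Set V, ∀ i, U i = G.reach (A \ P) N (r + i) ∩ H := ⟨_, fun _ => rfl⟩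
  have hmono : Monotone fun i => ((U i).ncard : ℝ) := by
    intro i j hij
    refine Nat.cast_le.2 (Set.ncard_le_ncard ?_)
    rw [hU, hU]
    exact Set.inter_subset_inter_left H (reach_mono (by omega : r + i ≤ r + j))
  have hσ0' : (σ : ℝ) ≤ (U 0).ncard := by
    rw [hU]; exact Nat.cast_le.2 hσ
  have hσ' : ∀ i, (σ : ℝ) ≤ (U i).ncard := fun i => hσ0'.trans (hmono (Nat.zero_le i))
  -- Deleting `P` costs at most `α σ / 4 ≤ α |U i| / 4` of the `α |U i| / 2` new vertices.
  have hg : ∀ i, ((U i).ncard : ℝ) ≤ Fintype.card V / 3 →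
      (1 + α / 4) * ((U i).ncard : ℝ) ≤ (U (i + 1)).ncard := by
    intro i hi
    have h1 := hH (U i) (by rw [hU]; exact Set.inter_subset_right) (by linarith)
    have h2 : U i ∪ ((G.externalNeighborhood (U i) ∩ H) \ P) ⊆ U (i + 1) := by
      rw [hU (i + 1)]
      rintro x (hx | ⟨⟨⟨-, u, hu, ha⟩, hxH⟩, hxP⟩)
      · rw [hU] at hx
        exact ⟨reach_mono (by omega) hx.1, hx.2⟩
      · rw [hU] at hu
        exact ⟨mem_reach_succ_of_adj hu.1 ⟨hHA hxH, hxP⟩ ha, hxH⟩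
    have hd : Disjoint (U i) ((G.externalNeighborhood (U i) ∩ H) \ P) :=
      Set.disjoint_left.2 fun x hx hx' => hx'.1.1.1 hx
    have h3 := Set.ncard_le_ncard h2
    rw [Set.ncard_union_eq hd] at h3
    have h4 : (G.externalNeighborhood (U i) ∩ H).ncard ≤
        ((G.externalNeighborhood (U i) ∩ H) \ P).ncard + P.ncard :=
      Set.ncard_le_ncard_sdiff_add_ncard _ _
    have h5 : ((U i).ncard : ℝ) + ((G.externalNeighborhood (U i) ∩ H) \ P).ncard ≤
      (U (i + 1)).ncard := by exact_mod_cast h3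
    have h6 : ((G.externalNeighborhood (U i) ∩ H).ncard : ℝ) ≤
        ((G.externalNeighborhood (U i) ∩ H) \ P).ncard + P.ncard := by exact_mod_cast h4
    have h7 : α / 4 * (σ : ℝ) ≤ α / 4 * (U i).ncard := by
      have := hσ' i
      gcongr
    linarith
  rw [← hU]
  rcases lt_or_pow_le_of_growth (s := σ) hσ0' (by positivity : 0 ≤ α / 4) hmono hg W with h | h
  · exact h
  -- Since `α W / 4 ≥ 250`, Bernoulli's inequality gives growth by a factor of at least `251`, while
  -- `σ ≥ n / 200`.
  · have h1 : 1 + (W : ℝ) * (α / 4) ≤ (1 + α / 4) ^ W :=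
      one_add_mul_le_pow (by linarith) W
    have h2 : (251 : ℝ) * σ ≤ (1 + α / 4) ^ W * σ := by
      gcongr
      linarith
    have h3 : (0 : ℝ) < σ := by exact_mod_cast hσ0
    have h4 := h2.trans h
    linarith

/-- Almost all vertices of an expander are first reached by a ball, grown outside a set with a small
inner boundary and outside a small set, at nearly the same time. -/
lemma IsExpander.exists_annulus (hα : 0 < α) (hα1 : α ≤ 1) (hG : G.IsExpander α) {W : ℕ}
    (hW : 1000 ≤ α * W) {Θ D P N H : Set V} {r σ : ℕ}
    (hD : ∀ u ∈ Θ, ∀ v ∉ Θ, G.Adj u v → u ∈ D) (hDc : D.ncard * W ≤ 2 * Fintype.card V)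
    (hPc : P.ncard * (100 * W ^ 2) ≤ Fintype.card V)
    (hHA : H ⊆ Θᶜ)
    (hH : ∀ U ⊆ H, (U.ncard : ℝ) ≤ 2 * Fintype.card V / 5 →
      α / 2 * U.ncard ≤ (G.externalNeighborhood U ∩ H).ncard)
    (hσn : Fintype.card V ≤ 200 * σ) (hσn' : 100 * σ ≤ Fintype.card V) (hσ0 : 1 ≤ σ)
    (hσ : σ ≤ (G.reach (Θᶜ \ P) N r ∩ H).ncard)
    (hσ' : (G.reach (Θᶜ \ P) N r ∩ H).ncard ≤ 2 * σ) :
    ∃ R : Set V, 50 * ((Rᶜ : Set V).ncard : ℝ) ≤ Fintype.card V ∧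
      ∀ x ∈ R, ∃ t, r ≤ t + W ∧ t ≤ r + 2 * W ∧ x ∈ G.reach (Θᶜ \ P) N t ∧
        ∀ s < t, x ∉ G.reach (Θᶜ \ P) N s := by
  have hn : (0 : ℝ) ≤ Fintype.card V := Nat.cast_nonneg _
  have hWpos : (1000 : ℝ) ≤ W := by nlinarith [(Nat.cast_nonneg W : (0:ℝ) ≤ W)]
  have hW1 : 1 ≤ W := by
    have : (1 : ℝ) ≤ W := by linarith
    exact_mod_cast this
  set β : ℕ → Set V := G.reach (Θᶜ \ P) N with hβ
  have hβmono : Monotone β := reach_mono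
  -- A copy of `β` delayed by `W + 1` and empty before that, so that a window of `W` steps before
  -- time `r` makes sense even when `r < W`.
  set γ : ℕ → Set V := fun i => if i < W + 1 then ∅ else β (i - (W + 1)) with hγ
  have hγmono : Monotone γ := by
    intro i j hij
    simp only [hγ]
    split_ifs with h1 h2
    · exact le_rfl
    · exact Set.empty_subset _
    · omega
    · exact hβmono (by omega)
  have hγadj : ∀ i u v, u ∈ γ i → v ∈ Θᶜ \ P → G.Adj u v → v ∈ γ (i + 1) := by
    intro i u v hu hv ha
    simp only [hγ] at hu ⊢
    split_ifs at hu with h1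
    · exact absurd hu (Set.notMem_empty u)
    · rw [if_neg (by omega), show i + 1 - (W + 1) = i - (W + 1) + 1 by omega]
      exact mem_reach_succ_of_adj hu hv ha
  obtain ⟨a, ha1, ha2, ha3⟩ := exists_small_increment hγmono r W hW1
  obtain ⟨b, hb1, hb2, hb3⟩ := exists_small_increment hβmono (r + W) W hW1
  have hγβ : γ (a + 1) ⊆ β r := by
    simp only [hγ]
    split_ifs
    · exact Set.empty_subset _
    · exact hβmono (by omega)
  -- The region between a thin layer before time `r` and one after time `r + W`. Its external
  -- neighbors lie in these two layers, in `P`, or in `D`.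
  set R := β b \ γ (a + 1) with hR
  set S := ((γ (a + 1) \ γ a) ∪ (β (b + 1) \ β b)) ∪ (P ∪ D) with hS
  have hNS : G.externalNeighborhood R ⊆ S := by
    rintro v ⟨hv, u, hu, ha⟩
    have hu' : u ∈ Θᶜ \ P := reach_subset _ hu.1
    by_cases hvΘ : v ∈ Θ
    · exact Or.inr (Or.inr (hD v hvΘ u hu'.1 ha.symm))
    · by_cases hvP : v ∈ P
      · exact Or.inr (Or.inl hvP)
      · left
        have hvA : v ∈ Θᶜ \ P := ⟨hvΘ, hvP⟩
        have hvb : v ∈ β (b + 1) := mem_reach_succ_of_adj hu.1 hvA ha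
        by_cases hvb' : v ∈ β b
        · have hvγ : v ∈ γ (a + 1) := by
            by_contra h
            exact hv ⟨hvb', h⟩
          exact Or.inl ⟨hvγ, fun h => hu.2 (hγadj a v u h hu' ha.symm)⟩
        · exact Or.inr ⟨hvb, hvb'⟩
  have hSc : (S.ncard : ℝ) * W ≤ 5 * Fintype.card V := by
    have h1 : S.ncard ≤ (γ (a + 1) \ γ a).ncard + (β (b + 1) \ β b).ncard + (P.ncard + D.ncard) :=
      (Set.ncard_union_le _ _).trans
        (Nat.add_le_add (Set.ncard_union_le _ _) (Set.ncard_union_le _ _))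
    have h2 : P.ncard * W ≤ Fintype.card V := by
      refine le_trans (Nat.mul_le_mul_left _ ?_) hPc
      nlinarith
    have h3 : S.ncard * W ≤ 5 * Fintype.card V := by
      calc S.ncard * W ≤ _ := Nat.mul_le_mul_right W h1
        _ = (γ (a + 1) \ γ a).ncard * W + (β (b + 1) \ β b).ncard * W + P.ncard * W
            + D.ncard * W := by ring
        _ ≤ _ := by omega
    exact_mod_cast h3
  have hbd : ∀ x : ℕ, α * x ≤ S.ncard → 200 * (x : ℝ) ≤ Fintype.card V := by
    intro x hx
    have h1 : α * x * W ≤ S.ncard * W := by gcongr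
    have h2 : (1000 : ℝ) * x ≤ α * W * x := by gcongr
    nlinarith
  have hS200 : 200 * (S.ncard : ℝ) ≤ Fintype.card V := by
    have : (1000 : ℝ) * S.ncard ≤ S.ncard * W := by
      rw [mul_comm]; gcongr
    linarith
  -- The trace on `H` exceeds `n / 3` at time `r + W` but was at most `2 σ ≤ n / 50` at time `r`. So
  -- `R` is not the small side of the separation.
  have hRbig : (Fintype.card V : ℝ) / 4 < R.ncard := by
    have hPσ : (P.ncard : ℝ) ≤ α / 4 * σ := by
      have h1 : (P.ncard : ℝ) * (100 * W ^ 2) ≤ Fintype.card V := by exact_mod_cast hPc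
      have h2 : (Fintype.card V : ℝ) ≤ 200 * σ := by exact_mod_cast hσn
      have h3 : (P.ncard : ℝ) * (1000 * W) ≤ P.ncard * W ^ 2 := by
        gcongr
        nlinarith
      have h4 : α * ((P.ncard : ℝ) * (100 * (1000 * W))) ≤ α * (200 * σ) :=
        mul_le_mul_of_nonneg_left (by linarith) hα.le
      have h5 : (P.ncard : ℝ) * 1000 ≤ P.ncard * (α * W) := by gcongr
      have h6 : (0 : ℝ) ≤ P.ncard := Nat.cast_nonneg _
      have h7 : 0 ≤ α * σ := by positivity
      nlinarith
    have h1 := third_lt_ncard_reach hα hW hHA hH (by exact_mod_cast hσn) hσ0 hPσ hσ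
    have h2 : G.reach (Θᶜ \ P) N (r + W) ∩ H ⊆ R ∪ (G.reach (Θᶜ \ P) N r ∩ H) := by
      rintro x ⟨hx, hxH⟩
      by_cases h : x ∈ γ (a + 1)
      · exact Or.inr ⟨hγβ h, hxH⟩
      · exact Or.inl ⟨hβmono hb1 hx, h⟩
    have h3 := (Set.ncard_le_ncard h2).trans (Set.ncard_union_le _ _)
    have h4 : ((G.reach (Θᶜ \ P) N (r + W) ∩ H).ncard : ℝ) ≤ R.ncard + 2 * σ := by
      exact_mod_cast h3.trans (Nat.add_le_add_left hσ' _)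
    have h5 : 100 * (σ : ℝ) ≤ Fintype.card V := by exact_mod_cast hσn'
    linarith
  refine ⟨R, ?_, ?_⟩
  · rcases hG.separation hNS with h | h
    · have := hbd _ h
      linarith
    · have h1 := hbd _ h
      have h2 : Rᶜ ⊆ (R ∪ S)ᶜ ∪ S := by
        intro x hx
        by_cases hxS : x ∈ S
        · exact Or.inr hxS
        · exact Or.inl (by simp only [Set.mem_compl_iff, Set.mem_union, not_or]; exact ⟨hx, hxS⟩)
      have h3 : ((Rᶜ : Set V).ncard : ℝ) ≤ ((R ∪ S)ᶜ : Set V).ncard + S.ncard := by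
        exact_mod_cast (Set.ncard_le_ncard h2).trans (Set.ncard_union_le _ _)
      linarith
  · rintro x ⟨hxb, hxγ⟩
    classical
    have hex : ∃ t, x ∈ β t := ⟨b, hxb⟩
    refine ⟨Nat.find hex, ?_, ?_, Nat.find_spec hex, fun s hs => Nat.find_min hex hs⟩
    · by_contra! hlt
      apply hxγ
      refine hγmono (show Nat.find hex + (W + 1) ≤ a + 1 by omega) ?_
      simp only [hγ]
      rw [if_neg (by omega), Nat.add_sub_cancel]
      exact Nat.find_spec hex
    · exact (Nat.find_min' hex hxb).trans (by omega)

end SimpleGraph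

/-! ### Breadth-first search trees -/

namespace SimpleGraph

variable {V : Type*} {G : SimpleGraph V}

/-- A breadth-first search tree with root `c`, given by levels and parents. -/
structure LevelTree (G : SimpleGraph V) (c : V) where
  /-- The distance from the root. -/
  lev : V → ℕ
  /-- The parent; the root is its own parent. -/
  par : V → V
  eq_root : ∀ v, lev v = 0 → v = c
  lev_par : ∀ v, lev (par v) = lev v - 1
  adj : ∀ v, lev v ≠ 0 → G.Adj (par v) v
  lev_le : ∀ u v, G.Adj u v → lev v ≤ lev u + 1
  mem_reach_iff : ∀ v i, v ∈ G.reach Set.univ {c} i ↔ lev v ≤ i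

lemma exists_levelTree (c : V) (hc : ∀ v, ∃ i, v ∈ G.reach Set.univ {c} i) :
    Nonempty (G.LevelTree c) := by
  classical
  have hiff : ∀ v i, v ∈ G.reach Set.univ {c} i ↔ Nat.find (hc v) ≤ i := fun v i =>
    ⟨fun h => Nat.find_min' _ h, fun h => reach_mono h (Nat.find_spec (hc v))⟩
  have hpar : ∀ v, ∃ u, (Nat.find (hc u) = Nat.find (hc v) - 1) ∧
      (Nat.find (hc v) ≠ 0 → G.Adj u v) := by
    intro v
    rcases h : Nat.find (hc v) with _ | i
    · exact ⟨v, by simp [h], by simp⟩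
    · have h1 : v ∈ G.reach Set.univ {c} (i + 1) := (hiff v _).2 h.le
      rcases h1 with h1 | ⟨-, u, hu, ha⟩
      · have := (hiff v i).1 h1
        omega
      · refine ⟨u, ?_, fun _ => ha⟩
        have h2 := (hiff u i).1 hu
        have h3 := (hiff v _).1 (mem_reach_succ_of_adj (Nat.find_spec (hc u)) (Set.mem_univ v) ha)
        omega
  choose par hp1 hp2 using hpar
  refine ⟨⟨fun v => Nat.find (hc v), par, ?_, hp1, hp2, ?_, hiff⟩⟩
  · intro v hv
    have := (hiff v 0).2 hv.le
    exact this.1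
  · intro u v ha
    exact (hiff v _).1 (mem_reach_succ_of_adj (Nat.find_spec (hc u)) (Set.mem_univ v) ha)

namespace LevelTree

variable {c : V} (T : G.LevelTree c)

lemma lev_iterate (k : ℕ) (v : V) : T.lev (T.par^[k] v) = T.lev v - k := by
  induction k with
  | zero => simp
  | succ k ih => rw [Function.iterate_succ_apply', T.lev_par, ih]; omega

/-- The ancestors of a vertex, including the vertex. -/
def anc (v : V) : Set V := {y | ∃ k, T.par^[k] v = y}

lemma self_mem_anc (v : V) : v ∈ T.anc v := ⟨0, rfl⟩

lemma iterate_mem_anc (v : V) (k : ℕ) : T.par^[k] v ∈ T.anc v := ⟨k, rfl⟩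

lemma anc_trans {x y z : V} (h : x ∈ T.anc y) (h' : y ∈ T.anc z) : x ∈ T.anc z := by
  obtain ⟨k, rfl⟩ := h
  obtain ⟨l, rfl⟩ := h'
  exact ⟨k + l, Function.iterate_add_apply _ _ _ _⟩

lemma lev_le_of_mem_anc {x y : V} (h : x ∈ T.anc y) : T.lev x ≤ T.lev y := by
  obtain ⟨k, rfl⟩ := h
  rw [T.lev_iterate]; omega

/-- Iterating `par` past the root stays at the root, so an ancestor is determined by its level. -/
lemma eq_iterate_of_mem_anc {x y : V} (h : x ∈ T.anc y) :
    x = T.par^[T.lev y - T.lev x] y := by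
  obtain ⟨k, rfl⟩ := h
  rw [T.lev_iterate]
  rcases le_or_gt k (T.lev y) with hk | hk
  · rw [show T.lev y - (T.lev y - k) = k by omega]
  · rw [T.eq_root (T.par^[k] y) (by rw [T.lev_iterate]; omega)]
    exact (T.eq_root _ (by rw [T.lev_iterate]; omega)).symm

lemma eq_of_mem_anc {x x' y : V} (h : x ∈ T.anc y) (h' : x' ∈ T.anc y) (he : T.lev x = T.lev x') :
    x = x' := by
  rw [T.eq_iterate_of_mem_anc h, T.eq_iterate_of_mem_anc h', he]

lemma iterate_mem_reach {A : Set V} (x : V) (k : ℕ) (hk : k ≤ T.lev x)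
    (hA : ∀ i ≤ k, T.par^[i] x ∈ A) : T.par^[k] x ∈ G.reach A {x} k := by
  induction k with
  | zero => exact mem_reach_self (hA 0 le_rfl) 0
  | succ k ih =>
    refine mem_reach_succ_of_adj (ih (by omega) fun i hi => hA i (by omega)) (hA _ le_rfl) ?_
    rw [Function.iterate_succ_apply']
    exact (T.adj _ (by rw [T.lev_iterate]; omega)).symm

/-- Two vertices are joined in the tree by a path through their ancestors. -/
lemma exists_tree_path (z x : V) : ∃ l, l ≤ T.lev z ∧ l ≤ T.lev x ∧
    (∃ y, y ∈ T.anc z ∧ y ∈ T.anc x ∧ T.lev y = l) ∧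
      G.HasPathIn (T.anc z ∪ T.anc x) z x (T.lev z + T.lev x - 2 * l) := by
  induction hs : T.lev z + T.lev x using Nat.strong_induction_on generalizing z x with
  | _ s ih =>
  by_cases hzx : z = x
  · subst hzx
    refine ⟨T.lev z, le_rfl, le_rfl, ⟨z, T.self_mem_anc z, T.self_mem_anc z, rfl⟩, ?_⟩
    rw [← hs, show T.lev z + T.lev z - 2 * T.lev z = 0 by omega]
    exact HasPathIn.refl (Or.inl (T.self_mem_anc z))
  -- Induction by moving the deeper vertex `a` to its parent: `a` is an ancestor neither of its
  -- parent nor of `b`, so it can be put in front of the path.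
  have step : ∀ a b : V, a ≠ b → T.lev b ≤ T.lev a → T.lev a + T.lev b = s →
      ∃ l, l ≤ T.lev a ∧ l ≤ T.lev b ∧ (∃ y, y ∈ T.anc a ∧ y ∈ T.anc b ∧ T.lev y = l) ∧
      G.HasPathIn (T.anc a ∪ T.anc b) a b (s - 2 * l) := by
    intro a b hab hle hsum
    have ha0 : T.lev a ≠ 0 := by
      intro h0
      exact hab ((T.eq_root a h0).trans (T.eq_root b (by omega)).symm)
    have hlp := T.lev_par a
    have hpa : T.par a ∈ T.anc a := ⟨1, rfl⟩
    obtain ⟨l, h1, h2, ⟨y, hy1, hy2, hy3⟩, hp⟩ :=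
      ih (T.lev (T.par a) + T.lev b) (by omega) (T.par a) b rfl
    refine ⟨l, by omega, h2, ⟨y, T.anc_trans hy1 hpa, hy2, hy3⟩, ?_⟩
    have hnot : a ∉ T.anc (T.par a) ∪ T.anc b := by
      rintro (h | h)
      · have := T.lev_le_of_mem_anc h
        omega
      · have h3 := T.lev_le_of_mem_anc h
        exact hab (T.eq_of_mem_anc h (T.self_mem_anc b) (by omega))
    have hq := hp.cons hnot (T.adj a ha0).symm
    rw [show s - 2 * l = T.lev (T.par a) + T.lev b - 2 * l + 1 by omega]
    refine hq.mono ?_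
    refine Set.insert_subset (Or.inl (T.self_mem_anc a)) (Set.union_subset ?_ ?_)
    · exact fun w hw => Or.inl (T.anc_trans hw hpa)
    · exact Set.subset_union_right
  rcases le_total (T.lev x) (T.lev z) with h | h
  · exact step z x hzx h hs
  · obtain ⟨l, h1, h2, ⟨y, hy1, hy2, hy3⟩, hp⟩ := step x z (Ne.symm hzx) h (by omega)
    exact ⟨l, h2, h1, ⟨y, hy2, hy1, hy3⟩, by rw [Set.union_comm]; exact hp.symm⟩

/-- The descendants of `v` up to level `R`. -/
def desc (R : ℕ) (v : V) : Set V := {x | T.lev x ≤ R ∧ v ∈ T.anc x}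

/-- Only few vertices within `W` consecutive levels have many descendants. -/
lemma ncard_mul_le_of_le_ncard_desc [Fintype V] {R m W K : ℕ} (hRm : R ≤ m + W) :
    {v | m < T.lev v ∧ T.lev v ≤ R ∧ K ≤ (T.desc R v).ncard}.ncard * K ≤ Fintype.card V * W := by
  classical
  set B : Set V := {v | m < T.lev v ∧ T.lev v ≤ R ∧ K ≤ (T.desc R v).ncard} with hB
  rw [Set.ncard_eq_toFinset_card' B]
  -- Double counting of pairs: each `x` has at most one ancestor on each of the at most `W` levels.
  refine Finset.card_mul_le_card_mul (t := Finset.univ) (fun v x => x ∈ T.desc R v) ?_ ?_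
  · intro v hv
    have hv' : v ∈ B := by simpa using hv
    refine hv'.2.2.trans ?_
    rw [Set.ncard_eq_toFinset_card']
    refine Finset.card_le_card fun x hx => ?_
    simpa [Finset.bipartiteAbove] using hx
  · intro x _
    have : (Finset.Ioc m R).card ≤ W := by rw [Nat.card_Ioc]; omega
    refine le_trans (Finset.card_le_card_of_injOn T.lev ?_ ?_) this
    · intro v hv
      have hv' : v ∈ B ∧ x ∈ T.desc R v := by simpa [Finset.bipartiteBelow] using hv
      simp only [Finset.coe_Ioc, Set.mem_Ioc]
      exact ⟨hv'.1.1, hv'.1.2.1⟩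
    · intro v hv w hw he
      have hv' : v ∈ B ∧ x ∈ T.desc R v := by simpa [Finset.bipartiteBelow] using hv
      have hw' : w ∈ B ∧ x ∈ T.desc R w := by simpa [Finset.bipartiteBelow] using hw
      exact T.eq_of_mem_anc hv'.2.2 hw'.2.2 he

/-- Climbing from a descendant `x` to `v` takes `lev x - lev v` steps. -/
lemma desc_subset_reach (R : ℕ) (v : V) :
    T.desc R v ⊆ G.reach Set.univ {v} (R - T.lev v) := by
  rintro x ⟨hxR, hx⟩
  have h1 := T.lev_le_of_mem_anc hx
  have h2 := T.iterate_mem_reach (A := Set.univ) x (T.lev x - T.lev v) (by omega) fun _ _ => trivial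
  rw [← T.eq_iterate_of_mem_anc hx] at h2
  exact reach_mono (by omega) (reach_symm h2)

end LevelTree

lemma ncard_biUnion_le_mul [Finite V] (P : Set V) (f : V → Set V) (K : ℕ)
    (hf : ∀ p ∈ P, (f p).ncard ≤ K) : (⋃ p ∈ P, f p).ncard ≤ P.ncard * K := by
  induction P, P.toFinite using Set.Finite.induction_on with
  | empty => simp
  | @insert a s ha _ ih =>
    rw [Set.biUnion_insert, Set.ncard_insert_of_notMem ha, add_mul, one_mul, add_comm]
    exact (Set.ncard_union_le _ _).trans
      (Nat.add_le_add (hf a (Or.inl rfl)) (ih fun p hp => hf p (Or.inr hp)))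

/-! ### The hub tree -/

section expander

variable [Fintype V] {α : ℝ}

/-- Expanders are connected: a component has no external neighbors, so separation by the empty set
applies. -/
lemma IsExpander.exists_mem_reach (hα : 0 < α) (hG : G.IsExpander α) (c v : V) :
    ∃ i, v ∈ G.reach Set.univ {c} i := by
  by_contra! h
  set C : Set V := {x | ∃ i, x ∈ G.reach Set.univ {c} i} with hC
  have h1 : G.externalNeighborhood C ⊆ ∅ := by
    rintro x ⟨hx, u, ⟨i, hu⟩, ha⟩
    exact hx ⟨i + 1, mem_reach_succ_of_adj hu trivial ha⟩
  have hc : c ∈ C := ⟨0, rfl, trivial⟩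
  have hv : v ∈ (C ∪ ∅)ᶜ := by
    simp only [Set.union_empty, Set.mem_compl_iff]
    rintro ⟨i, hi⟩
    exact h i hi
  have h2 : (0 : ℝ) < C.ncard := by exact_mod_cast (Set.ncard_pos).2 ⟨c, hc⟩
  have h3 : (0 : ℝ) < ((C ∪ ∅)ᶜ : Set V).ncard := by exact_mod_cast (Set.ncard_pos).2 ⟨v, hv⟩
  rcases hG.separation h1 with h | h
  · simp only [Set.ncard_empty, Nat.cast_zero] at h
    have := mul_pos hα h2
    linarith
  · simp only [Set.ncard_empty, Nat.cast_zero] at h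
    have := mul_pos hα h3
    linarith

/-- There is a vertex whose balls reach a tenth of the graph at the first time at which any balls
do so. -/
lemma IsExpander.exists_fastest_vertex (hα : 0 < α) (hG : G.IsExpander α)
    (hn : 10 < Fintype.card V) :
    ∃ (c : V) (R : ℕ), 1 ≤ R ∧ Fintype.card V ≤ 10 * (G.reach Set.univ {c} R).ncard ∧
      (∀ v, ∀ i < R, 10 * (G.reach Set.univ {v} i).ncard < Fintype.card V) ∧
      (1 + α) ^ (R - 1) ≤ Fintype.card V := by
  classical
  have hgrow : ∀ (c : V) (k : ℕ), (Fintype.card V : ℝ) / 2 < (G.reach Set.univ {c} k).ncard ∨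
      (1 + α) ^ k * 1 ≤ ((G.reach Set.univ {c} k).ncard : ℝ) := by
    intro c k
    refine lt_or_pow_le_of_growth (f := fun i => ((G.reach Set.univ {c} i).ncard : ℝ)) ?_ hα.le
      (fun i j hij => Nat.cast_le.2 (Set.ncard_le_ncard (reach_mono hij)))
      (fun i hi => hG.ball_growth c i hi) k
    have : 1 ≤ (G.reach Set.univ {c} 0).ncard :=
      (Set.ncard_pos).2 ⟨c, mem_reach_self (Set.mem_univ c) 0⟩
    exact_mod_cast this
  have hex : ∃ R, ∃ c : V, Fintype.card V ≤ 10 * (G.reach Set.univ {c} R).ncard := by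
    obtain ⟨c⟩ : Nonempty V := Fintype.card_pos_iff.1 (by omega)
    obtain ⟨k, hk⟩ := pow_unbounded_of_one_lt (Fintype.card V : ℝ) (by linarith : 1 < 1 + α)
    refine ⟨k, c, ?_⟩
    have h1 := ncard_le_card (G.reach Set.univ {c} k)
    have h2 : (Fintype.card V : ℝ) ≤ 10 * (G.reach Set.univ {c} k).ncard := by
      rcases hgrow c k with h | h
      · linarith [(Nat.cast_nonneg (Fintype.card V) : (0 : ℝ) ≤ _)]
      · linarith
    exact_mod_cast h2
  obtain ⟨c, hc⟩ := Nat.find_spec hex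
  have hmin : ∀ v, ∀ i < Nat.find hex, 10 * (G.reach Set.univ {v} i).ncard < Fintype.card V := by
    intro v i hi
    have := Nat.find_min hex hi
    push Not at this
    exact this v
  have h1 : 1 ≤ Nat.find hex := by
    by_contra! h0
    have h0' : Nat.find hex = 0 := by omega
    rw [h0'] at hc
    have : (G.reach Set.univ {c} 0).ncard ≤ 1 := by
      rw [← Set.ncard_singleton c]
      exact Set.ncard_le_ncard Set.inter_subset_left
    omega
  refine ⟨c, Nat.find hex, h1, hc, hmin, ?_⟩
  -- One step before the critical radius the ball is below `n / 10`, so it has grown by the factor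
  -- `1 + α` throughout.
  have h2 := hmin c (Nat.find hex - 1) (by omega)
  have h3 : 10 * ((G.reach Set.univ {c} (Nat.find hex - 1)).ncard : ℝ) < Fintype.card V := by
    exact_mod_cast h2
  rcases hgrow c (Nat.find hex - 1) with h | h
  · linarith [(Nat.cast_nonneg (Fintype.card V) : (0 : ℝ) ≤ _)]
  · linarith [(Nat.cast_nonneg (Fintype.card V) : (0 : ℝ) ≤ _)]

/-- An expander contains a set `Θ` with a small inner boundary such that after the removal of any
small set `P` outside of `Θ`, a positive proportion of the vertices is either in `Θ` or close to a
vertex of `Θ` that a path of nearly prescribed length inside `Θ` joins to a given `z`. -/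
theorem IsExpander.exists_hub_tree (hα : 0 < α) (hG : G.IsExpander α) {W : ℕ}
    (hW : 1000 ≤ α * W) (hW1 : 1000 ≤ W) (hn : W ≤ Fintype.card V) (hn' : 10 < Fintype.card V) :
    ∃ (Θ D : Set V) (R : ℕ), Θ.Nonempty ∧ (∀ u ∈ Θ, ∀ v ∉ Θ, G.Adj u v → u ∈ D) ∧
      5 * Θ.ncard ≤ Fintype.card V ∧ D.ncard * W ≤ 2 * Fintype.card V ∧
      (1 + α) ^ (R - 1) ≤ Fintype.card V ∧
      ∀ z ∈ Θ, ∃ κ ≤ 2 * R, ∀ P : Set V, Disjoint P Θ → P.ncard * (100 * W ^ 2) ≤ Fintype.card V →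
        ∃ S : Set V, Fintype.card V < 50 * S.ncard ∧ ∀ x ∈ S, x ∉ Θ →
          ∃ x' ∈ Θ, ∃ y ∈ Θᶜ \ P, G.Adj x' y ∧ y ∈ G.reach (Θᶜ \ P) {x} W ∧
            ∃ k, κ ≤ k + 2 * W ∧ k ≤ κ + W ∧ G.HasPathIn Θ z x' k := by
  obtain ⟨c, R, hR1, hcR, hfast, hRn⟩ := hG.exists_fastest_vertex hα hn'
  obtain ⟨T⟩ := exists_levelTree (G := G) c (hG.exists_mem_reach hα c)
  have hball : ∀ i, G.reach Set.univ {c} i = {v | T.lev v ≤ i} := fun i =>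
    Set.ext fun v => T.mem_reach_iff v i
  -- A thin level among the last `W` levels before `R`; if `R ≤ W`, level `0` serves, as it contains
  -- only the root.
  obtain ⟨m, hmR, hRm, hthin⟩ : ∃ m < R, R ≤ m + W ∧
      {v | T.lev v = m}.ncard * W ≤ Fintype.card V := by
    rcases le_or_gt R W with h | h
    · refine ⟨0, by omega, by omega, ?_⟩
      have h1 : {v | T.lev v = 0}.ncard ≤ 1 := by
        rw [← Set.ncard_singleton c]
        exact Set.ncard_le_ncard fun v hv => T.eq_root v hv
      calc _ ≤ 1 * W := Nat.mul_le_mul_right W h1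
        _ ≤ _ := by omega
    · obtain ⟨i, h1, h2, h3⟩ := exists_small_increment
        (reach_mono (G := G) (A := Set.univ) (X := {c})) (R - W - 1) W (by omega)
      refine ⟨i + 1, by omega, by omega, ?_⟩
      convert h3 using 3
      ext v
      rw [hball, hball]
      simp only [Set.mem_ofPred_eq, Set.mem_sdiff]
      omega
  -- Vertices above level number `m` with many descendants join `Θ`, so that deleting any vertex
  -- outside `Θ` cuts off fewer than `W ^ 2` descendants.
  set B : Set V := {v | m < T.lev v ∧ T.lev v ≤ R ∧ W ^ 2 ≤ (T.desc R v).ncard} with hB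
  have hBc : B.ncard * W ≤ Fintype.card V := by
    have h1 := T.ncard_mul_le_of_le_ncard_desc (K := W ^ 2) hRm
    rw [← hB] at h1
    have h2 : (B.ncard * W) * W ≤ Fintype.card V * W := by
      calc (B.ncard * W) * W = B.ncard * W ^ 2 := by ring
        _ ≤ _ := h1
    exact Nat.le_of_mul_le_mul_right h2 (by omega)
  set Θ : Set V := {v | T.lev v ≤ m} ∪ B with hΘ
  have hΘpar : ∀ v ∈ Θ, T.anc v ⊆ Θ := by
    intro v hv u hu
    rcases hv with hv | hv
    · exact Or.inl ((T.lev_le_of_mem_anc hu).trans hv)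
    · rcases le_or_gt (T.lev u) m with h | h
      · exact Or.inl h
      · refine Or.inr ⟨h, (T.lev_le_of_mem_anc hu).trans hv.2.1, hv.2.2.trans ?_⟩
        exact Set.ncard_le_ncard fun x hx => ⟨hx.1, T.anc_trans hu hx.2⟩
  refine ⟨Θ, {v | T.lev v = m} ∪ B, R, ?_, ?_, ?_, ?_, hRn, ?_⟩
  · exact ⟨c, Or.inl (Nat.le_trans ((T.mem_reach_iff c 0).1 (mem_reach_self (Set.mem_univ c) 0))
      (Nat.zero_le m))⟩
  · intro u hu v hv ha
    rcases hu with hu | hu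
    · have h1 := T.lev_le u v ha
      have h2 : ¬ T.lev v ≤ m := fun h => hv (Or.inl h)
      have hu' : T.lev u ≤ m := hu
      exact Or.inl (show T.lev u = m by omega)
    · exact Or.inr hu
  · have h1 := hfast c m hmR
    rw [hball] at h1
    have h2 : Θ.ncard ≤ {v | T.lev v ≤ m}.ncard + B.ncard := Set.ncard_union_le _ _
    have h3 : B.ncard * 1000 ≤ B.ncard * W := Nat.mul_le_mul_left _ hW1
    omega
  · have h1 : ({v | T.lev v = m} ∪ B).ncard ≤ _ := Set.ncard_union_le _ _
    calc _ ≤ ({v | T.lev v = m}.ncard + B.ncard) * W := Nat.mul_le_mul_right W h1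
      _ = {v | T.lev v = m}.ncard * W + B.ncard * W := by ring
      _ ≤ _ := by omega
  · intro z hz
    have hzR : T.lev z ≤ R := by
      rcases hz with hz | hz
      · exact le_trans hz hmR.le
      · exact hz.2.1
    refine ⟨T.lev z + m, by omega, fun P hPΘ hPc => ?_⟩
    -- `E` catches the vertices whose tree path to `z` branches at level at least `W`. They descend
    -- from the ancestor `w` of `z` at level `W`, hence lie in its ball of radius `R - W`. That ball
    -- would grow by a factor of at least `500` by radius `R - 1`, where every ball is still below
    -- `n / 10`.
    obtain ⟨E, hEc, hE⟩ : ∃ E : Set V, 100 * E.ncard ≤ Fintype.card V ∧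
        ∀ x, T.lev x ≤ R → ∀ y ∈ T.anc z, y ∈ T.anc x → W ≤ T.lev y → x ∈ E := by
      rcases lt_or_ge (T.lev z) W with h | h
      · refine ⟨∅, by simp, fun x _ y hy _ hWy => ?_⟩
        have := T.lev_le_of_mem_anc hy
        omega
      · set w := T.par^[T.lev z - W] z with hw
        have hlw : T.lev w = W := by rw [hw, T.lev_iterate]; omega
        refine ⟨T.desc R w, ?_, fun x hxR y hy hyx hWy => ⟨hxR, T.anc_trans ?_ hyx⟩⟩
        · have h1 : (T.desc R w).ncard ≤ (G.reach Set.univ {w} (R - W)).ncard := by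
            have := T.desc_subset_reach R w
            rw [hlw] at this
            exact Set.ncard_le_ncard this
          have h2 := hfast w (R - W + (W - 1)) (by omega)
          have h2' : 10 * ((G.reach Set.univ {w} (R - W + (W - 1))).ncard : ℝ) <
            Fintype.card V := by exact_mod_cast h2
          have h0 : (0 : ℝ) ≤ (G.reach Set.univ {w} (R - W)).ncard := Nat.cast_nonneg _
          have hn0 : (0 : ℝ) ≤ Fintype.card V := Nat.cast_nonneg _
          rcases lt_or_pow_le_of_growth (M := Fintype.card V / 2)
            (f := fun i => ((G.reach Set.univ {w} (R - W + i)).ncard : ℝ))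
            (s := (G.reach Set.univ {w} (R - W)).ncard) le_rfl hα.le
            (fun i j hij => Nat.cast_le.2 (Set.ncard_le_ncard (reach_mono (by omega))))
            (fun i hi => hG.ball_growth w (R - W + i) hi) (W - 1) with h3 | h3
          · linarith
          · have h4 : 1 + ((W - 1 : ℕ) : ℝ) * α ≤ (1 + α) ^ (W - 1) :=
              one_add_mul_le_pow (by linarith) _
            have h5 : (W : ℝ) ≤ 2 * ((W - 1 : ℕ) : ℝ) := by
              exact_mod_cast (by omega : W ≤ 2 * (W - 1))
            have h6 : (500 : ℝ) ≤ (1 + α) ^ (W - 1) := by nlinarith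
            have h7 : (500 : ℝ) * (G.reach Set.univ {w} (R - W)).ncard ≤
              (1 + α) ^ (W - 1) * (G.reach Set.univ {w} (R - W)).ncard := by gcongr
            have h8 : (100 : ℝ) * (T.desc R w).ncard ≤ Fintype.card V := by
              have : ((T.desc R w).ncard : ℝ) ≤ (G.reach Set.univ {w} (R - W)).ncard := by
                exact_mod_cast h1
              linarith
            exact_mod_cast h8
        · have h1 : y = T.par^[T.lev z - T.lev y] z := T.eq_iterate_of_mem_anc hy
          have h2 := T.lev_le_of_mem_anc hy
          refine ⟨T.lev y - W, ?_⟩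
          conv_lhs => rw [h1]
          rw [← Function.iterate_add_apply, hw, ← h1]
          congr 2
          omega
    have hPdesc : (⋃ p ∈ P, T.desc R p).ncard ≤ P.ncard * W ^ 2 := by
      refine ncard_biUnion_le_mul P _ _ fun p hp => ?_
      have hpΘ : p ∉ Θ := fun h => Set.disjoint_left.1 hPΘ hp h
      by_contra! hlt
      obtain ⟨x, hx⟩ : (T.desc R p).Nonempty := (Set.ncard_pos).1 (by omega)
      have h1 := T.lev_le_of_mem_anc hx.2
      refine hpΘ ?_
      rcases le_or_gt (T.lev p) m with h | h
      · exact Or.inl h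
      · exact Or.inr ⟨h, h1.trans hx.1, hlt.le⟩
    -- At least `n / 10` vertices have level at most `R`; the descendants of `P` and the set `E`
    -- remove at most `n / 100` each.
    refine ⟨{x | T.lev x ≤ R} \ ((⋃ p ∈ P, T.desc R p) ∪ E), ?_, ?_⟩
    · rw [hball] at hcR
      have h1 : {x | T.lev x ≤ R}.ncard ≤
          ({x | T.lev x ≤ R} \ ((⋃ p ∈ P, T.desc R p) ∪ E)).ncard +
            ((⋃ p ∈ P, T.desc R p) ∪ E).ncard := Set.ncard_le_ncard_sdiff_add_ncard _ _
      have h2 : ((⋃ p ∈ P, T.desc R p) ∪ E).ncard ≤ _ := Set.ncard_union_le _ _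
      have h3 : 100 * (P.ncard * W ^ 2) ≤ Fintype.card V := by
        rw [← mul_assoc, mul_comm 100, mul_assoc]; exact hPc
      omega
    · rintro x ⟨hxR, hx⟩ hxΘ
      have hxR' : T.lev x ≤ R := hxR
      rw [Set.mem_union, not_or] at hx
      have hxm : m < T.lev x := by
        by_contra! h
        exact hxΘ (Or.inl h)
      classical
      have hex : ∃ k, T.par^[k] x ∈ Θ :=
        ⟨T.lev x - m, Or.inl (show T.lev _ ≤ m by rw [T.lev_iterate]; omega)⟩
      -- The climb from `x` stops at its first ancestor in `Θ`. It avoids `P` because `x` descends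
      -- from no vertex of `P`, and it ends at a level between `m` and `m + W`.
      obtain ⟨k, hk, hkmin⟩ : ∃ k, T.par^[k] x ∈ Θ ∧ ∀ i < k, T.par^[i] x ∉ Θ :=
        ⟨Nat.find hex, Nat.find_spec hex, fun i hi => Nat.find_min hex hi⟩
      have hkm : k ≤ T.lev x - m := by
        by_contra! h
        exact hkmin _ h (Or.inl (show T.lev _ ≤ m by rw [T.lev_iterate]; omega))
      have hk0 : k ≠ 0 := by
        rintro rfl
        exact hxΘ hk
      obtain ⟨k, rfl⟩ := Nat.exists_eq_succ_of_ne_zero hk0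
      have hA : ∀ i ≤ k, T.par^[i] x ∈ Θᶜ \ P := fun i hi =>
        ⟨hkmin i (by omega), fun h => hx.1 (Set.mem_iUnion₂.2
          ⟨_, h, hxR', T.iterate_mem_anc x i⟩)⟩
      refine ⟨_, hk, T.par^[k] x, hA k le_rfl, ?_, ?_, ?_⟩
      · rw [Nat.succ_eq_add_one, Function.iterate_succ_apply']
        exact T.adj _ (by rw [T.lev_iterate]; omega)
      · exact reach_mono (by omega) (T.iterate_mem_reach x k (by omega) hA)
      · have hlx' := T.lev_iterate (k + 1) x
        set x' := T.par^[k + 1] x with hx'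
        obtain ⟨l, hl1, hl2, ⟨y, hy1, hy2, hy3⟩, hp⟩ := T.exists_tree_path z x'
        have hlW : l < W := by
          by_contra! h
          exact hx.2 (hE x hxR' y hy1 (T.anc_trans hy2 (T.iterate_mem_anc x (k + 1))) (by omega))
        -- The length is `lev z + lev x' - 2 * l` with `m ≤ lev x' ≤ m + W` and `l < W`, to be
        -- compared with `κ = lev z + m`.
        refine ⟨_, ?_, ?_, hp.mono (Set.union_subset (hΘpar z hz) (hΘpar x' hk))⟩
        · omega
        · omega

end expander

end SimpleGraph

/-! ### Closing the cycle -/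

namespace SimpleGraph

variable {V : Type*} {G : SimpleGraph V} [Fintype V] {α : ℝ}

/-- Inside a set `H` that expands, balls grow exponentially. -/
lemma lt_ncard_reach (hα : 0 < α) {A H : Set V} {v : V} {M σ : ℕ} (hHA : H ⊆ A)
    (hH : ∀ U ⊆ H, (U.ncard : ℝ) ≤ 2 * Fintype.card V / 5 →
      α / 2 * U.ncard ≤ (G.externalNeighborhood U ∩ H).ncard)
    (hv : v ∈ H) (hM : (Fintype.card V : ℝ) < (1 + α / 2) ^ M) (hσ : 3 * σ ≤ Fintype.card V) :
    σ < (G.reach A {v} M ∩ H).ncard := by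
  have hn : (0 : ℝ) ≤ Fintype.card V := Nat.cast_nonneg _
  obtain ⟨U, hU⟩ : ∃ U : ℕ → Set V, ∀ i, U i = G.reach A {v} i ∩ H := ⟨_, fun _ => rfl⟩
  have hmono : Monotone fun i => ((U i).ncard : ℝ) := by
    intro i j hij
    refine Nat.cast_le.2 (Set.ncard_le_ncard ?_)
    rw [hU, hU]
    exact Set.inter_subset_inter_left H (reach_mono hij)
  have h0 : (1 : ℝ) ≤ (U 0).ncard := by
    have : 1 ≤ (U 0).ncard :=
      (Set.ncard_pos).2 ⟨v, by rw [hU]; exact ⟨mem_reach_self (hHA hv) 0, hv⟩⟩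
    exact_mod_cast this
  have hg : ∀ i, ((U i).ncard : ℝ) ≤ Fintype.card V / 3 →
      (1 + α / 2) * ((U i).ncard : ℝ) ≤ (U (i + 1)).ncard := by
    intro i hi
    have h1 := hH (U i) (by rw [hU]; exact Set.inter_subset_right) (by linarith)
    have h2 : U i ∪ (G.externalNeighborhood (U i) ∩ H) ⊆ U (i + 1) := by
      rw [hU (i + 1)]
      rintro x (hx | ⟨⟨-, u, hu, ha⟩, hxH⟩)
      · rw [hU] at hx
        exact ⟨reach_mono (Nat.le_succ i) hx.1, hx.2⟩
      · rw [hU] at hu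
        exact ⟨mem_reach_succ_of_adj hu.1 (hHA hxH) ha, hxH⟩
    have hd : Disjoint (U i) (G.externalNeighborhood (U i) ∩ H) :=
      Set.disjoint_left.2 fun x hx hx' => hx'.1.1 hx
    have h3 := Set.ncard_le_ncard h2
    rw [Set.ncard_union_eq hd] at h3
    have h5 : ((U i).ncard : ℝ) + (G.externalNeighborhood (U i) ∩ H).ncard ≤
      (U (i + 1)).ncard := by exact_mod_cast h3
    linarith
  rw [← hU]
  have hσ' : 3 * (σ : ℝ) ≤ Fintype.card V := by exact_mod_cast hσ
  have key : (σ : ℝ) < (U M).ncard := by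
    rcases lt_or_pow_le_of_growth h0 (by positivity : 0 ≤ α / 2) hmono hg M with h | h
    · linarith
    · linarith
  exact_mod_cast key

/-- An expander contains cycles of all lengths up to an additive error `8 * W`. -/
theorem IsExpander.exists_cycle (hα : 0 < α) (hα1 : α ≤ 1) (hG : G.IsExpander α) {W M ℓ : ℕ}
    (hW : 1000 ≤ α * W) (hM : (Fintype.card V : ℝ) < (1 + α / 2) ^ M) (hMℓ : 3 * M ≤ ℓ)
    (hℓ : (ℓ + 4 * W) * (100 * W ^ 2) ≤ Fintype.card V) :
    ∃ k, ℓ ≤ k ∧ k ≤ ℓ + 8 * W ∧ G.HasCycleOfLength k := by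
  have hn : (0 : ℝ) ≤ Fintype.card V := Nat.cast_nonneg _
  have hW1 : 1000 ≤ W := by
    have : (1000 : ℝ) ≤ W := by nlinarith [(Nat.cast_nonneg W : (0:ℝ) ≤ W)]
    exact_mod_cast this
  have hWn : W ≤ Fintype.card V := by
    refine le_trans ?_ hℓ
    calc W ≤ ℓ + 4 * W := by omega
      _ = (ℓ + 4 * W) * 1 := by ring
      _ ≤ _ := Nat.mul_le_mul_left _ (by nlinarith)
  obtain ⟨Θ, D, R, hΘne, hD, hΘc, hDc, hR, hhub⟩ := hG.exists_hub_tree hα hW hW1 hWn (by omega)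
  have hRM : R ≤ M := by
    by_contra! h
    have h1 : (1 + α / 2) ^ M ≤ (1 + α) ^ (R - 1) :=
      calc (1 + α / 2) ^ M ≤ (1 + α) ^ M := by gcongr; linarith
        _ ≤ (1 + α) ^ (R - 1) := pow_le_pow_right₀ (by linarith) (by omega)
    linarith
  have hDc' : 20 * (D.ncard : ℝ) ≤ α * Fintype.card V := by
    have h1 : (D.ncard : ℝ) * W ≤ 2 * Fintype.card V := by exact_mod_cast hDc
    have h2 : α * ((D.ncard : ℝ) * W) ≤ α * (2 * Fintype.card V) :=
      mul_le_mul_of_nonneg_left h1 hα.le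
    have h3 : (D.ncard : ℝ) * 1000 ≤ D.ncard * (α * W) := by gcongr
    have h4 : 0 ≤ α * (Fintype.card V : ℝ) := by positivity
    linarith
  have hΘc' : (Θ.ncard : ℝ) ≤ Fintype.card V / 5 := by
    have : 5 * (Θ.ncard : ℝ) ≤ Fintype.card V := by exact_mod_cast hΘc
    linarith
  obtain ⟨H, hHΘ, hH, z, hz, v, hv, hzv⟩ := hG.exists_core hα hΘne hD hΘc' hDc'
  obtain ⟨κ, hκ, hhub⟩ := hhub z hz
  set σ := Fintype.card V / 100 with hσ
  -- Aims at total length `ℓ + 4 * W`: `L` for the outside path, `κ` for the inside one, and two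
  -- joining edges. The later errors are at most `4 * W` either way. As `κ ≤ 2 * R ≤ 2 * M` and `3 *
  -- M ≤ ℓ`, the radius `L` is at least `M`.
  set L := ℓ + 4 * W - κ - 2 with hL
  have hball : σ < (G.reach Θᶜ {v} L ∩ H).ncard :=
    lt_of_lt_of_le (lt_ncard_reach hα hHΘ hH hv hM (by omega))
      (Set.ncard_le_ncard (Set.inter_subset_inter_left H (reach_mono (by omega))))
  obtain ⟨j, r, P, w, N, hjr, hPΘ, hPc, hP, hN, hσ1, hσ2⟩ :=
    exists_path_with_ball H σ (by omega) L Θᶜ v (hHΘ hv) hball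
  have hPc' : P.ncard * (100 * W ^ 2) ≤ Fintype.card V :=
    le_trans (Nat.mul_le_mul_right _ (by omega)) hℓ
  have hPΘ' : Disjoint P Θ := Set.disjoint_left.2 fun x hx hx' => hPΘ hx hx'
  obtain ⟨S, hS, hhub⟩ := hhub P hPΘ' hPc'
  obtain ⟨A, hA, hAr⟩ := hG.exists_annulus hα hα1 hW hD hDc hPc' hHΘ hH (by omega) (by omega)
    (by omega) hσ1 hσ2
  -- `S` has more than `n / 50` vertices and the complement of `A` at most `n / 50`.
  obtain ⟨x, hxS, hxA⟩ : ∃ x ∈ S, x ∈ A := by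
    by_contra! h
    have h1 : S.ncard ≤ (Aᶜ : Set V).ncard := Set.ncard_le_ncard h
    have h2 : 50 * (Aᶜ : Set V).ncard ≤ Fintype.card V := by exact_mod_cast hA
    omega
  obtain ⟨t, ht1, ht2, hxt, hxmin⟩ := hAr x hxA
  obtain ⟨x', hx', y, hy, hxy, hyx, k, hk1, hk2, hpath⟩ :=
    hhub x hxS (reach_subset _ hxt).1
  classical
  have hyt : y ∈ G.reach (Θᶜ \ P) N (t + W) := reach_trans hxt hyx
  have hex : ∃ s, y ∈ G.reach (Θᶜ \ P) N s := ⟨_, hyt⟩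
  obtain ⟨s, hys, hsmin⟩ : ∃ s, y ∈ G.reach (Θᶜ \ P) N s ∧
      ∀ i < s, y ∉ G.reach (Θᶜ \ P) N i :=
    ⟨Nat.find hex, Nat.find_spec hex, fun i hi => Nat.find_min hex hi⟩
  have hst : s ≤ t + W := by
    by_contra! h
    exact hsmin _ h hyt
  have hts : t ≤ s + W := by
    by_contra! h
    exact hxmin _ h (reach_trans hys (reach_symm hyx))
  obtain ⟨u, huN, hu⟩ := exists_hasPathIn_of_first hys hsmin
  have hdisj : Disjoint P (G.reach (Θᶜ \ P) N s) :=
    Set.disjoint_left.2 fun a ha ha' => (reach_subset _ ha').2 ha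
  have hlong := hP.append hu hdisj (hN u huN)
  have hdisj' : Disjoint (P ∪ G.reach (Θᶜ \ P) N s) Θ := by
    rw [Set.disjoint_union_left]
    exact ⟨hPΘ', Set.disjoint_left.2 fun a ha ha' => (reach_subset _ ha).1 ha'⟩
  -- The length is `(j + s + 1) + k + 2`, where `j + r + 1 = L`, `s - r` lies between `-3 * W + W`
  -- and `3 * W`, and `k - κ` between `-2 * W` and `W`.
  exact ⟨_, by omega, by omega,
    hlong.hasCycleOfLength hpath.symm hdisj' hxy.symm hzv (by omega)⟩

end SimpleGraph

/-! ### Choice of the constants -/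

/-- Bernoulli's inequality for the exponent `α / 2 ≤ 1` gives `2 ^ (α / 2) ≤ 1 + α / 2`, which
converts the growth rate to base `2`. -/
lemma lt_one_add_half_pow {α x : ℝ} (hα : 0 < α) (hα1 : α ≤ 1) (hx : 0 < x) {M : ℕ}
    (hM : 2 * Real.logb 2 x / α < M) : x < (1 + α / 2) ^ M := by
  have h1 : (2 : ℝ) ^ (α / 2) ≤ 1 + α / 2 := by
    have := rpow_one_add_le_one_add_mul_self (s := 1) (p := α / 2) (by norm_num)
      (by positivity) (by linarith)
    norm_num at this
    exact this
  have h2 : Real.logb 2 x < α / 2 * M := by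
    rw [div_lt_iff₀ hα] at hM
    linarith
  calc x = (2 : ℝ) ^ Real.logb 2 x := (Real.rpow_logb (by norm_num) (by norm_num) hx).symm
    _ < (2 : ℝ) ^ (α / 2 * M) := Real.rpow_lt_rpow_of_exponent_lt (by norm_num) h2
    _ = ((2 : ℝ) ^ (α / 2)) ^ M := by rw [Real.rpow_mul (by norm_num), Real.rpow_natCast]
    _ ≤ (1 + α / 2) ^ M := by gcongr

/-- The right side is only quadratically small in `α`, so the required exponential bound holds with
much to spare. -/
lemma two_rpow_neg_le {α w : ℝ} (hα : 0 < α) (hα1 : α ≤ 1) (hw : 0 < w) (hαw : w ≤ 1001 / α) :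
    (2 : ℝ) ^ (-(10000 * Real.logb 2 (2 / α) / α)) ≤ 1 / (200 * w ^ 2) := by
  have h2α : 0 < 2 / α := by positivity
  have hlog : 1 ≤ Real.logb 2 (2 / α) := by
    rw [Real.le_logb_iff_rpow_le (by norm_num) h2α, Real.rpow_one, le_div_iff₀ hα]
    linarith
  have h1 : 2 * Real.logb 2 (2 / α) + 28 ≤ 10000 * Real.logb 2 (2 / α) / α := by
    rw [le_div_iff₀ hα]
    have : (2 * Real.logb 2 (2 / α) + 28) * α ≤ (2 * Real.logb 2 (2 / α) + 28) * 1 :=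
      mul_le_mul_of_nonneg_left hα1 (by linarith)
    linarith
  have h2 : (2 : ℝ) ^ (2 * Real.logb 2 (2 / α) + 28) = (2 / α) ^ 2 * 2 ^ 28 := by
    rw [Real.rpow_add (by norm_num), mul_comm 2 (Real.logb _ _), Real.rpow_mul (by norm_num),
      Real.rpow_logb (by norm_num) (by norm_num) h2α]
    norm_cast
  have h3 : 200 * w ^ 2 ≤ (2 / α) ^ 2 * 2 ^ 28 := by
    calc 200 * w ^ 2 ≤ 200 * (1001 / α) ^ 2 := by gcongr
      _ = (2 / α) ^ 2 * (200 * 1001 ^ 2 / 4) := by ring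
      _ ≤ (2 / α) ^ 2 * 2 ^ 28 := by gcongr; norm_num
  rw [Real.rpow_neg (by norm_num), one_div]
  refine inv_anti₀ (by positivity) (h3.trans ?_)
  rw [← h2]
  exact Real.rpow_le_rpow_of_exponent_le (by norm_num) h1

theorem theorem1 :
    ∃ C : ℝ, 0 < C ∧
      ∀ α : ℝ, 0 < α → α ≤ 1 →
        ∃ A a₁ a₂ : ℝ,
          (0 < A ∧ A ≤ C / α) ∧
          (0 < a₁ ∧ a₁ ≤ C / α) ∧
          (0 < a₂ ∧ (2 : ℝ) ^ (-(C * Real.logb 2 (2 / α) / α)) ≤ a₂) ∧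
          ∃ n₀ : ℕ, ∀ (n : ℕ), n₀ ≤ n →
            ∀ (V : Type*) [Fintype V] (G : SimpleGraph V),
              Fintype.card V = n → G.IsExpander α →
                ∀ ℓ : ℕ, a₁ * Real.logb 2 (n : ℝ) ≤ (ℓ : ℝ) → (ℓ : ℝ) ≤ a₂ * (n : ℝ) →
                  ∃ k : ℕ, ℓ ≤ k ∧ (k : ℝ) ≤ (ℓ : ℝ) + A ∧ G.HasCycleOfLength k := by
  refine ⟨10000, by norm_num, fun α hα hα1 => ?_⟩
  obtain ⟨W, hW1, hW2⟩ : ∃ W : ℕ, 1000 ≤ α * W ∧ (W : ℝ) ≤ 1001 / α := by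
    refine ⟨⌈1000 / α⌉₊, ?_, ?_⟩
    · rw [mul_comm, ← div_le_iff₀ hα]
      exact Nat.le_ceil _
    · have h1 := (Nat.ceil_lt_add_one (by positivity : (0 : ℝ) ≤ 1000 / α)).le
      have h2 : 1 ≤ 1 / α := by rw [le_div_iff₀ hα]; linarith
      have h3 : 1001 / α = 1000 / α + 1 / α := by ring
      linarith
  have hWpos : (0 : ℝ) < W := by
    by_contra! h
    nlinarith
  -- With `x = 2 * logb 2 n / α ≥ 2` and `M = ⌊x⌋₊ + 1`, the choice `12 / α` gives `ℓ ≥ 6 * x ≥ 3 *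
  -- M`. The bounds from `a₂` and `n₀` each provide half of `(ℓ + 4 * W) * (100 * W ^ 2) ≤ n`.
  refine ⟨8 * W, 12 / α, 1 / (200 * (W : ℝ) ^ 2), ⟨by positivity, ?_⟩, ⟨by positivity, ?_⟩,
    ⟨by positivity, two_rpow_neg_le hα hα1 hWpos hW2⟩, 800 * W ^ 3 + 2, ?_⟩
  · calc 8 * (W : ℝ) ≤ 8 * (1001 / α) := by gcongr
      _ = 8008 / α := by ring
      _ ≤ 10000 / α := by gcongr; norm_num
  · gcongr; norm_num
  intro n hn V _ G hV hG ℓ hℓ1 hℓ2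
  have hn2 : (2 : ℝ) ≤ n := by exact_mod_cast (by omega : 2 ≤ n)
  have hlog : 1 ≤ Real.logb 2 (n : ℝ) := by
    rw [Real.le_logb_iff_rpow_le (by norm_num) (by linarith), Real.rpow_one]
    exact hn2
  set x := 2 * Real.logb 2 (n : ℝ) / α with hx
  have hx2 : 2 ≤ x := by
    rw [hx, le_div_iff₀ hα]
    nlinarith
  have hM1 : x < ((⌊x⌋₊ + 1 : ℕ) : ℝ) := by
    push_cast
    exact Nat.lt_floor_add_one x
  have hM2 : 3 * (⌊x⌋₊ + 1) ≤ ℓ := by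
    have h1 := Nat.floor_le (by linarith : 0 ≤ x)
    have h2 : 12 / α * Real.logb 2 (n : ℝ) = 6 * x := by rw [hx]; ring
    have h3 : 3 * ((⌊x⌋₊ : ℝ) + 1) ≤ ℓ := by linarith
    exact_mod_cast h3
  have hℓ3 : (ℓ + 4 * W) * (100 * W ^ 2) ≤ n := by
    have h1 : 800 * (W : ℝ) ^ 3 ≤ n := by exact_mod_cast (by omega : 800 * W ^ 3 ≤ n)
    have h2 : (ℓ : ℝ) * (200 * W ^ 2) ≤ n := by
      rw [one_div, inv_mul_eq_div, le_div_iff₀ (by positivity)] at hℓ2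
      exact hℓ2
    have h3 : ((ℓ : ℝ) + 4 * W) * (100 * W ^ 2) ≤ n := by nlinarith
    exact_mod_cast h3
  subst hV
  obtain ⟨k, hk1, hk2, hk⟩ := hG.exists_cycle hα hα1 hW1
    (lt_one_add_half_pow hα hα1 (by linarith) hM1) hM2 hℓ3
  exact ⟨k, hk1, by exact_mod_cast hk2, hk⟩
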